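/- Theorem 2.5. For a (real or complex, not necessarily unital) Banach algebra $\mathfrak A$, let $\mathfrak A\widehat\otimes\mathfrak A$ be the completed projective tensor product, a Banach $\mathfrak A$-bimodule by $a\cdot(x\otimes y)=ax\otimes y$ and $(x\otimes y)\cdot a=x\otimes ya$, and let $\pi\colon\mathfrak A\widehat\otimes\mathfrak A\to\mathfrak A$, $\pi(x\otimes y)=xy$, be the multiplication map. Let $\mathfrak A\widehat\otimes_{\mathfrak A}\mathfrak A$ be the quotient of $\mathfrak A\widehat\otimes\mathfrak A$ by the closed linear span of the elements $ab\otimes c-a\otimes bc$ $(a,b,c\in\mathfrak A)$. $\bullet$ $\mathfrak A$ is biprojective if $\pi$ has a bounded right inverse $\rho\colon\mathfrak A\to\mathfrak A\widehat\otimes\mathfrak A$ that is an $\mathfrak A$-bimodule homomorphism. $\bullet$ $\mathfrak A$ is biflat if the adjoint $\pi^*\colon\mathfrak A^*\to(\mathfrak A\widehat\otimes\mathfrak A)^*$ has a bounded left inverse $\lambda\colon(\mathfrak A\widehat\otimes\mathfrak A)^*\to\mathfrak A^*$ that is an $\mathfrak A$-bimodule homomorphism for the dual actions $(a\cdot f)(x)=f(x\cdot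 a)$, $(f\cdot a)(x)=f(a\cdot x)$. $\bullet$ $\mathfrak A$ is self-induced if the bounded map $\mathfrak A\widehat\otimes_{\mathfrak A}\mathfrak A\to\mathfrak A$ induced by $\pi$ is a topological linear isomorphism (it is then automatically an isomorphism of Banach $\mathfrak A$-bimodules). Let $\mathfrak A$ be a closed two-sided ideal of a Banach algebra $\mathfrak B$. If $\mathfrak B$ is biprojective, then $\mathfrak A$ is biprojective if and only if $\mathfrak A$ is self-induced. If $\mathfrak B$ is biflat, then $\mathfrak A$ is biflat if and only if $\mathfrak A$ is self-induced. -/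

import Mathlib

open scoped TensorProduct

set_option linter.unusedSectionVars false

noncomputable section

namespace BanachTensor

section Tensor

variable (𝕜 : Type*) [RCLike 𝕜]
variable (E F : Type*) [NormedAddCommGroup E] [NormedSpace 𝕜 E]
  [NormedAddCommGroup F] [NormedSpace 𝕜 F]

/-- The algebraic tensor product `E ⊗ F`, as a type synonym that carries the projective
seminorm. -/
def AlgTensor : Type _ := E ⊗[𝕜] F

instance : AddCommGroup (AlgTensor 𝕜 E F) := inferInstanceAs (AddCommGroup (E ⊗[𝕜] F))
instance : Module 𝕜 (AlgTensor 𝕜 E F) := inferInstanceAs (Module 𝕜 (E ⊗[𝕜] F))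

variable {𝕜 E F}

/-- The elementary tensor `x ⊗ y` in the algebraic tensor product. -/
def algTmul (x : E) (y : F) : AlgTensor 𝕜 E F := x ⊗ₜ[𝕜] y

/-- The finite families `(xᵢ, yᵢ)` with `∑ xᵢ ⊗ yᵢ = t`. -/
abbrev Reps (t : AlgTensor 𝕜 E F) : Type _ :=
  {l : List (E × F) // (l.map fun p => algTmul (𝕜 := 𝕜) p.1 p.2).sum = t}

/-- The cost `∑ ‖xᵢ‖ ‖yᵢ‖` of a finite family. -/
def cost (l : List (E × F)) : ℝ := (l.map fun p => ‖p.1‖ * ‖p.2‖).sum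

/-- The projective norm: the infimum of `∑ ‖xᵢ‖ ‖yᵢ‖` over all finite representations
`t = ∑ xᵢ ⊗ yᵢ`. -/
def projNorm (t : AlgTensor 𝕜 E F) : ℝ := ⨅ l : Reps t, cost l.1

theorem cost_nonneg (l : List (E × F)) : 0 ≤ cost l := by
  refine List.sum_nonneg fun a ha => ?_
  obtain ⟨p, -, rfl⟩ := List.mem_map.1 ha
  positivity

theorem bddBelow_cost (t : AlgTensor 𝕜 E F) :
    BddBelow (Set.range fun l : Reps t => cost l.1) :=
  ⟨0, by rintro _ ⟨l, rfl⟩; exact cost_nonneg _⟩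

/-- Multiplying a representation by a scalar. -/
theorem sum_smul_rep (c : 𝕜) (l : List (E × F)) :
    ((l.map fun p => (c • p.1, p.2)).map fun p => algTmul (𝕜 := 𝕜) p.1 p.2).sum
      = c • (l.map fun p => algTmul (𝕜 := 𝕜) p.1 p.2).sum := by
  induction l with
  | nil => simp
  | cons p l ih =>
    simp only [List.map_cons, List.sum_cons, smul_add, ih]
    congr 1

theorem cost_smul_rep (c : 𝕜) (l : List (E × F)) :
    cost (l.map fun p => (c • p.1, p.2)) = ‖c‖ * cost l := by
  induction l with
  | nil => simp [cost]
  | cons p l ih =>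
    simp only [cost, List.map_cons, List.sum_cons, norm_smul, mul_add] at ih ⊢
    rw [ih, mul_assoc]

instance (t : AlgTensor 𝕜 E F) : Nonempty (Reps t) := by
  have key : ∀ t : E ⊗[𝕜] F, ∃ l : List (E × F),
      (l.map fun p => algTmul (𝕜 := 𝕜) p.1 p.2).sum = (t : AlgTensor 𝕜 E F) := by
    intro t
    induction t using TensorProduct.induction_on with
    | zero => exact ⟨[], rfl⟩
    | tmul x y => exact ⟨[(x, y)], add_zero (algTmul (𝕜 := 𝕜) x y)⟩
    | add s t hs ht =>
      obtain ⟨l, hl⟩ := hs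
      obtain ⟨m, hm⟩ := ht
      exact ⟨l ++ m, by rw [List.map_append, List.sum_append, hl, hm]; rfl⟩
  obtain ⟨l, hl⟩ := key t
  exact ⟨⟨l, hl⟩⟩

theorem projNorm_le (l : List (E × F)) :
    projNorm ((l.map fun p => algTmul (𝕜 := 𝕜) p.1 p.2).sum) ≤ cost l :=
  ciInf_le (bddBelow_cost _) (⟨l, rfl⟩ : Reps _)

theorem projNorm_nonneg (t : AlgTensor 𝕜 E F) : 0 ≤ projNorm t :=
  le_ciInf fun l => cost_nonneg l.1

theorem projNorm_zero : projNorm (0 : AlgTensor 𝕜 E F) = 0 :=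
  le_antisymm (by simpa [cost] using projNorm_le (𝕜 := 𝕜) ([] : List (E × F)))
    (projNorm_nonneg _)

theorem projNorm_add_le (s t : AlgTensor 𝕜 E F) :
    projNorm (s + t) ≤ projNorm s + projNorm t := by
  refine le_ciInf_add_ciInf fun ⟨l, hl⟩ ⟨m, hm⟩ => ?_
  have h := projNorm_le (𝕜 := 𝕜) (l ++ m)
  rw [List.map_append, List.sum_append, hl, hm] at h
  simpa [cost] using h

theorem projNorm_smul_le (c : 𝕜) (t : AlgTensor 𝕜 E F) :
    projNorm (c • t) ≤ ‖c‖ * projNorm t := by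
  rw [projNorm.eq_def t, Real.mul_iInf_of_nonneg (norm_nonneg _)]
  refine le_ciInf fun ⟨l, hl⟩ => ?_
  have h := projNorm_le (𝕜 := 𝕜) (l.map fun p => (c • p.1, p.2))
  rwa [sum_smul_rep, hl, cost_smul_rep] at h

variable (𝕜 E F) in
/-- The projective seminorm on the algebraic tensor product. -/
def projSeminorm : Seminorm 𝕜 (AlgTensor 𝕜 E F) :=
  Seminorm.ofSMulLE projNorm projNorm_zero projNorm_add_le projNorm_smul_le

instance : SeminormedAddCommGroup (AlgTensor 𝕜 E F) :=
  (projSeminorm 𝕜 E F).toAddGroupSeminorm.toSeminormedAddCommGroup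

instance : NormedSpace 𝕜 (AlgTensor 𝕜 E F) := ⟨projNorm_smul_le⟩

theorem norm_algTmul_le (x : E) (y : F) : ‖algTmul (𝕜 := 𝕜) x y‖ ≤ ‖x‖ * ‖y‖ := by
  change projNorm _ ≤ _
  have h := projNorm_le (𝕜 := 𝕜) [(x, y)]
  simpa [cost] using h

variable (𝕜 E F) in
/-- The completed projective tensor product `E ⊗̂ F`. -/
abbrev ProjTensor : Type _ := UniformSpace.Completion (AlgTensor 𝕜 E F)

variable (𝕜) in
/-- The elementary tensor `x ⊗ y` in `E ⊗̂ F`. -/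
def tmul (x : E) (y : F) : ProjTensor 𝕜 E F := (algTmul (𝕜 := 𝕜) x y : AlgTensor 𝕜 E F)

variable (𝕜 E F) in
/-- The bounded bilinear map `(x, y) ↦ x ⊗ y`. -/
def tmulL : E →L[𝕜] F →L[𝕜] ProjTensor 𝕜 E F :=
  LinearMap.mkContinuous₂
    (((TensorProduct.mk 𝕜 E F : E →ₗ[𝕜] F →ₗ[𝕜] E ⊗[𝕜] F) :
      E →ₗ[𝕜] F →ₗ[𝕜] AlgTensor 𝕜 E F).compr₂
      (UniformSpace.Completion.toComplL (𝕜 := 𝕜) (E := AlgTensor 𝕜 E F)).toLinearMap) 1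
    (fun x y => by
      rw [one_mul]
      refine le_trans (le_of_eq ?_) (norm_algTmul_le (𝕜 := 𝕜) x y)
      exact UniformSpace.Completion.norm_coe (algTmul (𝕜 := 𝕜) x y))

theorem tmulL_apply (x : E) (y : F) : tmulL 𝕜 E F x y = tmul 𝕜 x y := rfl

variable {G : Type*} [NormedAddCommGroup G] [NormedSpace 𝕜 G]

/-- The linear map on `E ⊗ F` induced by a bounded bilinear map. -/
def algLiftₗ (f : E →L[𝕜] F →L[𝕜] G) : AlgTensor 𝕜 E F →ₗ[𝕜] G :=
  (TensorProduct.lift (f.toLinearMap₁₂) : E ⊗[𝕜] F →ₗ[𝕜] G)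

theorem algLiftₗ_algTmul (f : E →L[𝕜] F →L[𝕜] G) (x : E) (y : F) :
    algLiftₗ f (algTmul x y) = f x y := by
  unfold algLiftₗ algTmul
  exact TensorProduct.lift.tmul x y

theorem norm_algLiftₗ_le (f : E →L[𝕜] F →L[𝕜] G) (t : AlgTensor 𝕜 E F) :
    ‖algLiftₗ f t‖ ≤ ‖f‖ * ‖t‖ := by
  change _ ≤ ‖f‖ * projNorm t
  rw [projNorm.eq_def t, Real.mul_iInf_of_nonneg (norm_nonneg f)]
  refine le_ciInf fun ⟨l, hl⟩ => ?_
  subst hl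
  induction l with
  | nil => simp [cost]
  | cons p l ih =>
    simp only [cost, List.map_cons, List.sum_cons, map_add, mul_add, algLiftₗ_algTmul] at ih ⊢
    refine (norm_add_le _ _).trans (add_le_add ?_ (ih ⟨l, rfl⟩))
    rw [← mul_assoc]
    exact f.le_opNorm₂ _ _

variable [CompleteSpace G]

/-- The bounded linear map `E ⊗̂ F → G` induced by a bounded bilinear map `f`; it is determined
by `x ⊗ y ↦ f x y`. -/
def lift (f : E →L[𝕜] F →L[𝕜] G) : ProjTensor 𝕜 E F →L[𝕜] G :=
  ((algLiftₗ f).mkContinuous ‖f‖ (norm_algLiftₗ_le f)).extend UniformSpace.Completion.toComplL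

theorem lift_tmul (f : E →L[𝕜] F →L[𝕜] G) (x : E) (y : F) : lift f (tmul 𝕜 x y) = f x y := by
  refine (ContinuousLinearMap.extend_eq _ ?_ ?_ (algTmul (𝕜 := 𝕜) x y)).trans
    (algLiftₗ_algTmul f x y)
  · exact UniformSpace.Completion.denseRange_coe
  · exact UniformSpace.Completion.isUniformInducing_coe _

end Tensor

section Algebra

/-- A subalgebra of a normed algebra is a normed space, with the restricted norm. -/
instance {𝕜 : Type*} [RCLike 𝕜] {B : Type*} [NonUnitalNormedRing B] [NormedSpace 𝕜 B]
    (A : NonUnitalSubalgebra 𝕜 B) : NormedSpace 𝕜 A :=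
  ⟨fun c x => norm_smul_le c (x : B)⟩

variable (𝕜 : Type*) [RCLike 𝕜]
variable (A : Type*) [NonUnitalNormedRing A] [NormedSpace 𝕜 A]
  [IsScalarTower 𝕜 A A] [SMulCommClass 𝕜 A A]

variable {A} in
/-- The left action of `a` on `A ⊗̂ A`: `a · (x ⊗ y) = (a x) ⊗ y`. -/
def leftAct (a : A) : ProjTensor 𝕜 A A →L[𝕜] ProjTensor 𝕜 A A :=
  lift ((tmulL 𝕜 A A).comp (ContinuousLinearMap.mul 𝕜 A a))

variable {A} in
/-- The right action of `a` on `A ⊗̂ A`: `(x ⊗ y) · a = x ⊗ (y a)`. -/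
def rightAct (a : A) : ProjTensor 𝕜 A A →L[𝕜] ProjTensor 𝕜 A A :=
  lift (((tmulL 𝕜 A A).flip.comp ((ContinuousLinearMap.mul 𝕜 A).flip a)).flip)

theorem leftAct_tmul (a x y : A) : leftAct 𝕜 a (tmul 𝕜 x y) = tmul 𝕜 (a * x) y :=
  lift_tmul _ x y

theorem rightAct_tmul (a x y : A) : rightAct 𝕜 a (tmul 𝕜 x y) = tmul 𝕜 x (y * a) :=
  lift_tmul _ x y

/-- The closed linear span in `A ⊗̂ A` of the elements `(a b) ⊗ c - a ⊗ (b c)`. -/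
def balancing : Submodule 𝕜 (ProjTensor 𝕜 A A) :=
  (Submodule.span 𝕜 {t | ∃ a b c : A, t = tmul 𝕜 (a * b) c - tmul 𝕜 a (b * c)}).topologicalClosure

/-- The `A`-balanced projective tensor product `A ⊗̂_A A`, with the quotient norm. -/
abbrev BalancedTensor : Type _ := ProjTensor 𝕜 A A ⧸ balancing 𝕜 A

variable [CompleteSpace A]

/-- The multiplication map `A ⊗̂ A → A`, `x ⊗ y ↦ x y`. -/
def mulMap : ProjTensor 𝕜 A A →L[𝕜] A := lift (ContinuousLinearMap.mul 𝕜 A)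

theorem mulMap_tmul (x y : A) : mulMap 𝕜 A (tmul 𝕜 x y) = x * y := lift_tmul _ x y

theorem balancing_le_ker : balancing 𝕜 A ≤ (mulMap 𝕜 A).ker := by
  refine Submodule.topologicalClosure_minimal _ ?_ (mulMap 𝕜 A).isClosed_ker
  rw [Submodule.span_le]
  rintro _ ⟨a, b, c, rfl⟩
  simp [mulMap_tmul, mul_assoc]

/-- The map `A ⊗̂_A A → A` induced by multiplication. -/
def balancedMulMap : BalancedTensor 𝕜 A →L[𝕜] A :=
  (balancing 𝕜 A).liftQL (mulMap 𝕜 A) (balancing_le_ker 𝕜 A)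

/-- `A` is self-induced: multiplication induces a (topological) isomorphism `A ⊗̂_A A → A`. -/
def IsSelfInduced : Prop :=
  ∃ e : BalancedTensor 𝕜 A ≃L[𝕜] A, (e : BalancedTensor 𝕜 A →L[𝕜] A) = balancedMulMap 𝕜 A

/-- `A` is biprojective: the multiplication map `A ⊗̂ A → A` has a bounded right inverse that is
an `A`-bimodule homomorphism. -/
def IsBiprojective : Prop :=
  ∃ ρ : A →L[𝕜] ProjTensor 𝕜 A A,
    (∀ a x : A, ρ (a * x) = leftAct 𝕜 a (ρ x)) ∧
    (∀ a x : A, ρ (x * a) = rightAct 𝕜 a (ρ x)) ∧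
    ∀ x : A, mulMap 𝕜 A (ρ x) = x

/-- `A` is biflat: the adjoint `A* → (A ⊗̂ A)*` of the multiplication map has a bounded left
inverse that is an `A`-bimodule homomorphism. On the dual of a bimodule the actions are
`(a · f)(x) = f (x · a)` and `(f · a)(x) = f (a · x)`. -/
def IsBiflat : Prop :=
  ∃ l : StrongDual 𝕜 (ProjTensor 𝕜 A A) →L[𝕜] StrongDual 𝕜 A,
    (∀ (a : A) (f : StrongDual 𝕜 (ProjTensor 𝕜 A A)) (x : A),
      l (f.comp (rightAct 𝕜 a)) x = l f (x * a)) ∧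
    (∀ (a : A) (f : StrongDual 𝕜 (ProjTensor 𝕜 A A)) (x : A),
      l (f.comp (leftAct 𝕜 a)) x = l f (a * x)) ∧
    ∀ f : StrongDual 𝕜 A, l (f.comp (mulMap 𝕜 A)) = f

end Algebra

end BanachTensor

end

noncomputable section

set_option maxSynthPendingDepth 3

open ContinuousLinearMap

namespace BanachTensor

/-! ### Bounded maps out of the projective tensor product -/

section Tensor

variable {𝕜 : Type*} [RCLike 𝕜]
variable {E F : Type*} [NormedAddCommGroup E] [NormedSpace 𝕜 E]
  [NormedAddCommGroup F] [NormedSpace 𝕜 F]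
variable {G : Type*} [NormedAddCommGroup G] [NormedSpace 𝕜 G]

/-! Write `π` for multiplication and `q` for the quotient map onto the balanced tensor product. If
`ρ` is a right-module section of `π`, then `q (ρ (x y)) = q (ρ x · y) = q (π (ρ x) ⊗ y) = q (x ⊗
y)`, so `q ∘ ρ` inverts the induced multiplication (`IsBiprojective.isSelfInduced`). Biflatness
gives the dual identity, and Hahn-Banach turns it into a lower bound and dense range
(`IsBiflat.isSelfInduced`).

Conversely, let `A` be a self-induced ideal of `B` with section `ρ` on `B`. On `A`, `ρ b` lies only
in `B ⊗̂ B`, but `a · ρ b · c` can be read in `A ⊗̂ A`, since `a u ⊗ v c` has both factors in the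
ideal (`IdealEmbedding.compress`). This expression is balanced in `a, b, c`, so self-inducedness
makes it a bounded linear function of `a b c` (`IsSelfInduced.exists_factor₃`). The required
identities need checking only on triple products (`IsSelfInduced.ext₃`). The biflat case runs the
same construction with values in a bidual. -/

/-- Bounded linear maps on `E ⊗̂ F` are determined by their values on elementary tensors. -/
theorem projTensor_ext {S T : ProjTensor 𝕜 E F →L[𝕜] G}
    (h : ∀ x y, S (tmul 𝕜 x y) = T (tmul 𝕜 x y)) : S = T := by
  have key : ∀ t : AlgTensor 𝕜 E F, S (t : ProjTensor 𝕜 E F) = T (t : ProjTensor 𝕜 E F) := by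
    have h' : ((S.toLinearMap ∘ₗ
        (UniformSpace.Completion.toComplL (𝕜 := 𝕜) (E := AlgTensor 𝕜 E F)).toLinearMap :
          AlgTensor 𝕜 E F →ₗ[𝕜] G) : E ⊗[𝕜] F →ₗ[𝕜] G) =
        ((T.toLinearMap ∘ₗ
        (UniformSpace.Completion.toComplL (𝕜 := 𝕜) (E := AlgTensor 𝕜 E F)).toLinearMap :
          AlgTensor 𝕜 E F →ₗ[𝕜] G) : E ⊗[𝕜] F →ₗ[𝕜] G) :=
      TensorProduct.ext' h
    exact fun t => LinearMap.congr_fun h' t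
  ext t
  exact UniformSpace.Completion.induction_on t (isClosed_eq S.continuous T.continuous) key

theorem norm_lift_le [CompleteSpace G] (f : E →L[𝕜] F →L[𝕜] G) : ‖lift f‖ ≤ ‖f‖ := by
  refine opNorm_le_bound _ (norm_nonneg f) fun t => ?_
  refine UniformSpace.Completion.induction_on t
    (isClosed_le (by fun_prop) (by fun_prop)) fun t => ?_
  rw [UniformSpace.Completion.norm_coe]
  refine le_trans (le_of_eq ?_) (norm_algLiftₗ_le f t)
  congr 1
  refine ContinuousLinearMap.extend_eq _ ?_ ?_ t
  · exact UniformSpace.Completion.denseRange_coe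
  · exact UniformSpace.Completion.isUniformInducing_coe _

end Tensor

/-! ### Self-induced algebras: uniqueness and factorization through products -/

section SelfInduced

variable {𝕜 : Type*} [RCLike 𝕜]
variable {A : Type*} [NonUnitalNormedRing A] [NormedSpace 𝕜 A]
  [IsScalarTower 𝕜 A A] [SMulCommClass 𝕜 A A]
variable {G : Type*} [NormedAddCommGroup G] [NormedSpace 𝕜 G]

theorem tmul_sub_tmul_mem_balancing (a b c : A) :
    tmul 𝕜 (a * b) c - tmul 𝕜 a (b * c) ∈ balancing 𝕜 A :=
  Submodule.le_topologicalClosure _ (Submodule.subset_span ⟨a, b, c, rfl⟩)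

instance isClosed_balancing : IsClosed (balancing 𝕜 A : Set (ProjTensor 𝕜 A A)) :=
  Submodule.isClosed_topologicalClosure _

theorem balancing_le_ker_of_balanced {T : ProjTensor 𝕜 A A →L[𝕜] G}
    (hT : ∀ a b c : A, T (tmul 𝕜 (a * b) c) = T (tmul 𝕜 a (b * c))) :
    balancing 𝕜 A ≤ T.ker := by
  refine Submodule.topologicalClosure_minimal _ ?_ T.isClosed_ker
  rw [Submodule.span_le]
  rintro _ ⟨a, b, c, rfl⟩
  simp [hT]

variable [CompleteSpace A]

theorem balancedMulMap_mk (t : ProjTensor 𝕜 A A) :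
    balancedMulMap 𝕜 A (Submodule.Quotient.mk t) = mulMap 𝕜 A t := rfl

theorem IsSelfInduced.mulMap_surjective (h : IsSelfInduced 𝕜 A) :
    Function.Surjective (mulMap 𝕜 A) := by
  obtain ⟨e, he⟩ := h
  intro x
  obtain ⟨t, ht⟩ := Submodule.Quotient.mk_surjective _ (e.symm x)
  refine ⟨t, ?_⟩
  rw [← balancedMulMap_mk, ht, ← he]
  exact e.apply_symm_apply x

/-- Over a self-induced algebra, bounded linear maps are determined by their values on
products. -/
theorem IsSelfInduced.ext (h : IsSelfInduced 𝕜 A) {S T : A →L[𝕜] G}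
    (hST : ∀ x y, S (x * y) = T (x * y)) : S = T := by
  have key : S.comp (mulMap 𝕜 A) = T.comp (mulMap 𝕜 A) :=
    projTensor_ext fun x y => by simpa [mulMap_tmul] using hST x y
  ext x
  obtain ⟨t, rfl⟩ := h.mulMap_surjective x
  exact congr($key t)

/-- Over a self-induced algebra, bounded linear maps are determined by their values on
triple products. -/
theorem IsSelfInduced.ext₃ (h : IsSelfInduced 𝕜 A) {S T : A →L[𝕜] G}
    (hST : ∀ x y z, S (x * y * z) = T (x * y * z)) : S = T := by
  refine h.ext fun x z => ?_
  have key : S.comp ((ContinuousLinearMap.mul 𝕜 A).flip z) =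
      T.comp ((ContinuousLinearMap.mul 𝕜 A).flip z) := h.ext fun x y => hST x y z
  exact congr($key x)

/-- Over a self-induced algebra, a balanced bounded bilinear map factors through
multiplication. -/
theorem IsSelfInduced.exists_factor [CompleteSpace G] (h : IsSelfInduced 𝕜 A)
    (f : A →L[𝕜] A →L[𝕜] G) (hf : ∀ a b c, f (a * b) c = f a (b * c)) :
    ∃ T : A →L[𝕜] G, ∀ x y, T (x * y) = f x y := by
  obtain ⟨e, he⟩ := h
  have hker : balancing 𝕜 A ≤ (lift f).ker :=
    balancing_le_ker_of_balanced fun a b c => by simp only [lift_tmul, hf]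
  refine ⟨((balancing 𝕜 A).liftQL (lift f) hker).comp
    (e.symm : A →L[𝕜] BalancedTensor 𝕜 A), fun x y => ?_⟩
  have hxy : e.symm (x * y) = Submodule.Quotient.mk (tmul 𝕜 x y) := by
    rw [ContinuousLinearEquiv.symm_apply_eq, ← mulMap_tmul 𝕜 A x y, ← balancedMulMap_mk, ← he]
    rfl
  rw [comp_apply, ContinuousLinearEquiv.coe_coe, hxy]
  exact lift_tmul f x y

/-- Over a self-induced algebra, a balanced bounded trilinear map `(a, c, b) ↦ Φ a c b` factors
through the triple product `a b c`. -/
theorem IsSelfInduced.exists_factor₃ [CompleteSpace G] (h : IsSelfInduced 𝕜 A)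
    (Φ : A →L[𝕜] A →L[𝕜] A →L[𝕜] G)
    (hl : ∀ a x b c, Φ (a * x) c b = Φ a c (x * b))
    (hr : ∀ a b x c, Φ a (x * c) b = Φ a c (b * x)) :
    ∃ T : A →L[𝕜] G, ∀ a b c, T (a * b * c) = Φ a c b := by
  let f : A →L[𝕜] A →L[𝕜] A →L[𝕜] G :=
    ((flipₗᵢ 𝕜 A A G : (A →L[𝕜] A →L[𝕜] G) →L[𝕜] A →L[𝕜] A →L[𝕜] G)).comp Φ
  have hfa : ∀ a b c, f a b c = Φ a c b := fun _ _ _ => rfl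
  -- Factor twice: `F` absorbs `a b` and takes values in maps of `c`, then `T` absorbs `(a b) c`.
  obtain ⟨F, hF⟩ := h.exists_factor f fun a b c => by
    ext z
    simp only [hfa, hl]
  obtain ⟨T, hT⟩ := h.exists_factor F fun x b c => by
    -- `F` is known only on products, so its balancedness is tested at `x y` in place of `x`, where
    -- it becomes `hr`.
    have key : (F.flip c).comp ((ContinuousLinearMap.mul 𝕜 A).flip b) = F.flip (b * c) :=
      h.ext fun x y => by
        simp only [comp_apply, flip_apply, mul_apply', mul_assoc, hF, hfa, hr]
    exact congr($key x)
  exact ⟨T, fun a b c => by rw [hT, hF, hfa]⟩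

variable {X Y : Type*} [NormedAddCommGroup X] [NormedSpace 𝕜 X]
  [NormedAddCommGroup Y] [NormedSpace 𝕜 Y]

/-- The factorization of `IsSelfInduced.exists_factor₃` for `(a, b, c) ↦ Θ a c (ρ b)`. -/
theorem IsSelfInduced.exists_factor_comp [CompleteSpace Y] (h : IsSelfInduced 𝕜 A)
    (Θ : A →L[𝕜] A →L[𝕜] X →L[𝕜] Y) (ρ : A →L[𝕜] X)
    (hl : ∀ a x b c, Θ (a * x) c (ρ b) = Θ a c (ρ (x * b)))
    (hr : ∀ a b x c, Θ a (x * c) (ρ b) = Θ a c (ρ (b * x))) :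
    ∃ T : A →L[𝕜] Y, ∀ a b c, T (a * b * c) = Θ a c (ρ b) :=
  h.exists_factor₃ ((compL 𝕜 A (X →L[𝕜] Y) (A →L[𝕜] Y) ((compL 𝕜 A X Y).flip ρ)).comp Θ) hl hr

/-- The factorization of `IsSelfInduced.exists_factor₃` for the `Y**`-valued map
`(a, b, c) ↦ (f ↦ r (f ∘ Θ a c) b)`. -/
theorem IsSelfInduced.exists_factor_dual (h : IsSelfInduced 𝕜 A)
    (Θ : A →L[𝕜] A →L[𝕜] X →L[𝕜] Y) (r : StrongDual 𝕜 X →L[𝕜] StrongDual 𝕜 A)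
    (hl : ∀ a x b c (f : StrongDual 𝕜 Y),
      r (f.comp (Θ (a * x) c)) b = r (f.comp (Θ a c)) (x * b))
    (hr : ∀ a b x c (f : StrongDual 𝕜 Y),
      r (f.comp (Θ a (x * c))) b = r (f.comp (Θ a c)) (b * x)) :
    ∃ T : StrongDual 𝕜 Y →L[𝕜] StrongDual 𝕜 A,
      ∀ f a b c, T f (a * b * c) = r (f.comp (Θ a c)) b := by
  -- `P S b` is the functional `f ↦ r (f ∘ S) b` on `Y*`.
  let P : (X →L[𝕜] Y) →L[𝕜] A →L[𝕜] StrongDual 𝕜 (StrongDual 𝕜 Y) :=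
    (flipₗᵢ 𝕜 (StrongDual 𝕜 Y) A 𝕜 :
      (StrongDual 𝕜 Y →L[𝕜] A →L[𝕜] 𝕜) →L[𝕜] A →L[𝕜] StrongDual 𝕜 Y →L[𝕜] 𝕜).comp
      ((compL 𝕜 (StrongDual 𝕜 Y) (StrongDual 𝕜 X) (StrongDual 𝕜 A) r).comp (compL 𝕜 X Y 𝕜).flip)
  obtain ⟨T, hT⟩ := h.exists_factor₃ ((compL 𝕜 A (X →L[𝕜] Y) _ P).comp Θ)
    (fun a x b c => by
      ext f
      exact hl a x b c f)
    (fun a b x c => by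
      ext f
      exact hr a b x c f)
  exact ⟨T.flip, fun f a b c => congr($(hT a b c) f)⟩

/-! ### Biprojective and biflat algebras are self-induced -/

/-- A biprojective Banach algebra is self-induced. -/
theorem IsBiprojective.isSelfInduced (h : IsBiprojective 𝕜 A) : IsSelfInduced 𝕜 A := by
  obtain ⟨ρ, -, hr, hπ⟩ := h
  let q : ProjTensor 𝕜 A A →L[𝕜] BalancedTensor 𝕜 A := (balancing 𝕜 A).mkQL
  have hq : ∀ t, q t = Submodule.Quotient.mk t := fun _ => rfl
  -- For `s = u ⊗ v` this is the balancing relation `u v ⊗ y ~ u ⊗ v y`.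
  have hbal : ∀ (y : A) (s : ProjTensor 𝕜 A A),
      q (tmul 𝕜 (mulMap 𝕜 A s) y) = q (rightAct 𝕜 y s) := by
    intro y s
    have key : q.comp (((tmulL 𝕜 A A).flip y).comp (mulMap 𝕜 A)) =
        q.comp (rightAct 𝕜 y) := by
      refine projTensor_ext fun u v => ?_
      simp only [comp_apply, flip_apply, tmulL_apply, mulMap_tmul, rightAct_tmul, hq]
      exact (Submodule.Quotient.eq _).2 (tmul_sub_tmul_mem_balancing u v y)
    exact congr($key s)
  have hρ : (q.comp ρ).comp (mulMap 𝕜 A) = q := by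
    refine projTensor_ext fun x y => ?_
    simp only [comp_apply, mulMap_tmul, hr]
    rw [← hbal, hπ]
  refine ⟨ContinuousLinearEquiv.equivOfInverse (balancedMulMap 𝕜 A) (q.comp ρ) ?_ ?_, ?_⟩
  · intro t
    obtain ⟨t, rfl⟩ := Submodule.Quotient.mk_surjective _ t
    exact congr($hρ t)
  · exact hπ
  · rfl

/-- A biflat Banach algebra is self-induced. -/
theorem IsBiflat.isSelfInduced (h : IsBiflat 𝕜 A) : IsSelfInduced 𝕜 A := by
  obtain ⟨l, hr, -, hπ⟩ := h
  let q : ProjTensor 𝕜 A A →L[𝕜] BalancedTensor 𝕜 A := (balancing 𝕜 A).mkQL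
  have hq : ∀ t, q t = Submodule.Quotient.mk t := fun _ => rfl
  -- Every `f ∘ q` is in the image of `π*`: its translate by `y` is `π*` of `u ↦ f (q (u ⊗ y))`, and
  -- `l` undoes `π*`.
  have hdual : ∀ f : StrongDual 𝕜 (BalancedTensor 𝕜 A),
      (l (f.comp q)).comp (mulMap 𝕜 A) = f.comp q := by
    intro f
    refine projTensor_ext fun x y => ?_
    have hy : (f.comp q).comp (rightAct 𝕜 y) =
        ((f.comp q).comp ((tmulL 𝕜 A A).flip y)).comp (mulMap 𝕜 A) := by
      refine projTensor_ext fun u v => ?_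
      simp only [comp_apply, flip_apply, tmulL_apply, mulMap_tmul, rightAct_tmul, hq]
      exact congr_arg f ((Submodule.Quotient.eq _).2 (tmul_sub_tmul_mem_balancing u v y)).symm
    rw [comp_apply, mulMap_tmul, ← hr, hy, hπ]
    rfl
  -- Test `hdual` on a norming functional of norm at most 1.
  have hbound : ∀ t, ‖t‖ ≤ ‖l‖ * ‖q‖ * ‖balancedMulMap 𝕜 A t‖ := by
    intro t
    obtain ⟨f, hf, hft⟩ := exists_dual_vector'' 𝕜 t
    obtain ⟨s, rfl⟩ := Submodule.Quotient.mk_surjective _ t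
    have h1 : f (q s) = l (f.comp q) (mulMap 𝕜 A s) := congr($(hdual f) s).symm
    calc ‖q s‖ = ‖f (q s)‖ := by
          rw [hq, hft, RCLike.norm_ofReal, abs_norm]
      _ ≤ ‖l (f.comp q)‖ * ‖mulMap 𝕜 A s‖ := h1 ▸ le_opNorm _ _
      _ ≤ ‖l‖ * ‖q‖ * ‖mulMap 𝕜 A s‖ := by
          gcongr
          refine (le_opNorm _ _).trans ?_
          gcongr
          exact (opNorm_comp_le _ _).trans (mul_le_of_le_one_left (norm_nonneg _) hf)
  have hanti : AntilipschitzWith (‖l‖₊ * ‖q‖₊) (balancedMulMap 𝕜 A) :=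
    antilipschitz_of_bound _ hbound
  have hclosed : IsClosed (Set.range (balancedMulMap 𝕜 A)) :=
    hanti.isClosed_range (balancedMulMap 𝕜 A).uniformContinuous
  have hker : (balancedMulMap 𝕜 A).ker = ⊥ :=
    LinearMap.ker_eq_bot.2 hanti.injective
  -- A functional `g` vanishing on the closed range satisfies `g ∘ π = 0`, hence `g = l (g ∘ π) =
  -- 0`.
  have hrange : (balancedMulMap 𝕜 A).range = ⊤ := by
    have hcl : IsClosed ((balancedMulMap 𝕜 A).range : Set A) := hclosed
    refine (Submodule.eq_top_iff'.2 fun x => ?_)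
    obtain ⟨f, -, hf⟩ := exists_dual_vector'' 𝕜
      ((Submodule.Quotient.mk x : A ⧸ (balancedMulMap 𝕜 A).range))
    have h0 : (f.comp (balancedMulMap 𝕜 A).range.mkQL).comp (mulMap 𝕜 A) = 0 := by
      ext t
      have ht : (balancedMulMap 𝕜 A).range.mkQL (mulMap 𝕜 A t) = 0 :=
        (Submodule.Quotient.mk_eq_zero _).2 ⟨Submodule.Quotient.mk t, rfl⟩
      rw [comp_apply, comp_apply, ht, map_zero, zero_apply]
    have hfx : f (Submodule.Quotient.mk x) = 0 := by
      have h1 := hπ (f.comp (balancedMulMap 𝕜 A).range.mkQL)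
      rw [h0, map_zero] at h1
      exact congr($h1 x).symm
    rw [hf, RCLike.ofReal_eq_zero, norm_eq_zero] at hfx
    exact (Submodule.Quotient.mk_eq_zero _).1 hfx
  exact ⟨ContinuousLinearEquiv.ofBijective _ hker hrange,
    ContinuousLinearEquiv.coe_ofBijective _ hker hrange⟩

end SelfInduced

/-! ### Compression to an ideal -/

section Ideal

/-- A Banach algebra `A` sitting in `B` as a two-sided ideal: an injective homomorphism
`incl : A → B` with bounded actions `mulRight a u = a u` and `mulLeft c v = v c`. -/
structure IdealEmbedding (𝕜 A B : Type*) [RCLike 𝕜]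
    [NonUnitalNormedRing A] [NormedSpace 𝕜 A] [NonUnitalNormedRing B] [NormedSpace 𝕜 B] where
  /-- The inclusion. -/
  incl : A →L[𝕜] B
  /-- The product `a u` of `a ∈ A` and `u ∈ B`. -/
  mulRight : A →L[𝕜] B →L[𝕜] A
  /-- The product `v c` of `c ∈ A` and `v ∈ B`. -/
  mulLeft : A →L[𝕜] B →L[𝕜] A
  incl_injective : Function.Injective incl
  incl_mul : ∀ a b, incl (a * b) = incl a * incl b
  incl_mulRight : ∀ a u, incl (mulRight a u) = incl a * u
  incl_mulLeft : ∀ c v, incl (mulLeft c v) = v * incl c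

/-- The ideal embedding given by a subalgebra that is a two-sided ideal. -/
def IdealEmbedding.ofSubalgebra {𝕜 : Type*} [RCLike 𝕜] {B : Type*} [NonUnitalNormedRing B]
    [NormedSpace 𝕜 B] [IsScalarTower 𝕜 B B] [SMulCommClass 𝕜 B B] {A : NonUnitalSubalgebra 𝕜 B}
    (hleft : ∀ b : B, ∀ a ∈ A, b * a ∈ A) (hright : ∀ b : B, ∀ a ∈ A, a * b ∈ A) :
    IdealEmbedding 𝕜 A B where
  incl := LinearMap.mkContinuous
    { toFun := fun a => a, map_add' := fun _ _ => rfl, map_smul' := fun _ _ => rfl } 1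
    fun a => (one_mul ‖a‖).ge
  mulRight := LinearMap.mkContinuous₂
    (LinearMap.mk₂ 𝕜 (fun (a : A) (u : B) => (⟨a * u, hright u a a.2⟩ : A))
      (fun a a' u => Subtype.ext (add_mul (a : B) a' u))
      (fun c a u => Subtype.ext (smul_mul_assoc c (a : B) u))
      (fun a u u' => Subtype.ext (mul_add (a : B) u u'))
      (fun c a u => Subtype.ext (mul_smul_comm c (a : B) u))) 1
    fun a u => by
      rw [one_mul]
      exact norm_mul_le (a : B) u
  mulLeft := LinearMap.mkContinuous₂
    (LinearMap.mk₂ 𝕜 (fun (c : A) (v : B) => (⟨v * c, hleft v c c.2⟩ : A))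
      (fun a a' u => Subtype.ext (mul_add u (a : B) a'))
      (fun c a u => Subtype.ext (mul_smul_comm c u (a : B)))
      (fun a u u' => Subtype.ext (add_mul u u' (a : B)))
      (fun c a u => Subtype.ext (smul_mul_assoc c u (a : B)))) 1
    fun c v => by
      rw [one_mul, mul_comm]
      exact norm_mul_le v (c : B)
  incl_injective := Subtype.val_injective
  incl_mul := fun _ _ => rfl
  incl_mulRight := fun _ _ => rfl
  incl_mulLeft := fun _ _ => rfl

variable {𝕜 : Type*} [RCLike 𝕜]
variable {A : Type*} [NonUnitalNormedRing A] [NormedSpace 𝕜 A]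
  [IsScalarTower 𝕜 A A] [SMulCommClass 𝕜 A A]
variable {B : Type*} [NonUnitalNormedRing B] [NormedSpace 𝕜 B]
  [IsScalarTower 𝕜 B B] [SMulCommClass 𝕜 B B]
variable (I : IdealEmbedding 𝕜 A B)

namespace IdealEmbedding

/-- For `a, c` in a two-sided ideal `A` of `B`, the map `B ⊗̂ B → A ⊗̂ A`,
`u ⊗ v ↦ (a u) ⊗ (v c)`. -/
def compress : A →L[𝕜] A →L[𝕜] ProjTensor 𝕜 B B →L[𝕜] ProjTensor 𝕜 A A :=
  LinearMap.mkContinuous₂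
    (LinearMap.mk₂ 𝕜 (fun a c : A => lift ((tmulL 𝕜 A A).bilinearComp
        (I.mulRight a) (I.mulLeft c)))
      (fun a a' c => projTensor_ext fun u v => by simp [lift_tmul])
      (fun k a c => projTensor_ext fun u v => by simp [lift_tmul])
      (fun a c c' => projTensor_ext fun u v => by simp [lift_tmul])
      (fun k a c => projTensor_ext fun u v => by simp [lift_tmul]))
    (‖tmulL 𝕜 A A‖ * ‖I.mulRight‖ * ‖I.mulLeft‖)
    fun a c => by
      refine (norm_lift_le _).trans (opNorm_le_bound₂ _ (by positivity) fun u v => ?_)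
      calc ‖tmulL 𝕜 A A (I.mulRight a u) (I.mulLeft c v)‖
          ≤ ‖tmulL 𝕜 A A‖ * ‖I.mulRight a u‖ *
              ‖I.mulLeft c v‖ := le_opNorm₂ _ _ _
        _ ≤ ‖tmulL 𝕜 A A‖ * (‖I.mulRight‖ * ‖a‖ * ‖u‖) *
              (‖I.mulLeft‖ * ‖c‖ * ‖v‖) := by
            gcongr <;> exact le_opNorm₂ _ _ _
        _ = _ := by ring

theorem compress_tmul (a c : A) (u v : B) :
    I.compress a c (tmul 𝕜 u v) =
      tmul 𝕜 (I.mulRight a u) (I.mulLeft c v) :=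
  lift_tmul _ u v

/-- Moves a factor of `a` onto the tensor over `B`, where the module property of the splitting
passes it to the middle variable; this gives balancedness. -/
theorem compress_mul_left (a x c : A) :
    I.compress (a * x) c =
      (I.compress a c).comp (leftAct 𝕜 (I.incl x)) :=
  projTensor_ext fun u v => by
    simp only [comp_apply, leftAct_tmul, compress_tmul]
    congr 1
    exact I.incl_injective (by simp only [incl_mul, incl_mulRight, mul_assoc])

theorem compress_mul_right (a x c : A) :
    I.compress a (x * c) =
      (I.compress a c).comp (rightAct 𝕜 (I.incl x)) :=
  projTensor_ext fun u v => by
    simp only [comp_apply, rightAct_tmul, compress_tmul]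
    congr 1
    exact I.incl_injective (by simp only [incl_mul, incl_mulLeft, mul_assoc])

/-- Makes the factored map a left-module homomorphism: an outer factor is absorbed into `a`. -/
theorem leftAct_comp_compress (x a c : A) :
    (leftAct 𝕜 x).comp (I.compress a c) = I.compress (x * a) c :=
  projTensor_ext fun u v => by
    simp only [comp_apply, leftAct_tmul, compress_tmul]
    congr 1
    exact I.incl_injective (by simp only [incl_mul, incl_mulRight, mul_assoc])

theorem rightAct_comp_compress (x a c : A) :
    (rightAct 𝕜 x).comp (I.compress a c) = I.compress a (c * x) :=
  projTensor_ext fun u v => by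
    simp only [comp_apply, rightAct_tmul, compress_tmul]
    congr 1
    exact I.incl_injective (by simp only [incl_mul, incl_mulLeft, mul_assoc])

/-- Since `(a u)(v c) = a (u v) c`, a splitting of multiplication on `B` yields one on triple
products in `A`. -/
theorem mulMap_comp_compress [CompleteSpace A] [CompleteSpace B] (a c : A) :
    (mulMap 𝕜 A).comp (I.compress a c) =
      ((I.mulLeft c).comp
        (I.incl.comp (I.mulRight a))).comp (mulMap 𝕜 B) :=
  projTensor_ext fun u v => by
    simp only [comp_apply, compress_tmul, mulMap_tmul]
    exact I.incl_injective (by simp only [incl_mul, incl_mulRight, incl_mulLeft, mul_assoc])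

end IdealEmbedding

/-! ### Self-induced ideals inherit biprojectivity and biflatness -/

variable [CompleteSpace A] [CompleteSpace B]

/-- A self-induced closed ideal of a biprojective Banach algebra is biprojective. -/
theorem IsBiprojective.of_isSelfInduced_ideal (hB : IsBiprojective 𝕜 B)
    (I : IdealEmbedding 𝕜 A B) (hA : IsSelfInduced 𝕜 A) : IsBiprojective 𝕜 A := by
  obtain ⟨ρ, hρl, hρr, hρπ⟩ := hB
  obtain ⟨T, hT⟩ := hA.exists_factor_comp I.compress (ρ.comp I.incl)
    (fun a x b c => by
      rw [I.compress_mul_left, comp_apply, comp_apply, comp_apply, I.incl_mul, hρl])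
    (fun a b x c => by
      rw [I.compress_mul_right, comp_apply, comp_apply, comp_apply, I.incl_mul, hρr])
  refine ⟨T, fun a x => ?_, fun a x => ?_, fun x => ?_⟩
  · have key : T.comp (ContinuousLinearMap.mul 𝕜 A a) = (leftAct 𝕜 a).comp T :=
      hA.ext₃ fun x y z => by
        rw [comp_apply, mul_apply', ← mul_assoc, ← mul_assoc, hT, ← I.leftAct_comp_compress, comp_apply,
          comp_apply (leftAct 𝕜 a) T, hT]
    exact congr($key x)
  · have key : T.comp ((ContinuousLinearMap.mul 𝕜 A).flip a) = (rightAct 𝕜 a).comp T :=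
      hA.ext₃ fun x y z => by
        rw [comp_apply, flip_apply, mul_apply', mul_assoc _ z, hT, ← I.rightAct_comp_compress, comp_apply,
          comp_apply (rightAct 𝕜 a) T, hT]
    exact congr($key x)
  · have key : (mulMap 𝕜 A).comp T = ContinuousLinearMap.id 𝕜 A :=
      hA.ext₃ fun x y z => by
        have h := congr($(I.mulMap_comp_compress x z) (ρ (I.incl y)))
        simp only [comp_apply, hρπ] at h
        rw [comp_apply, hT, comp_apply ρ, h]
        exact I.incl_injective (by
          simp only [I.incl_mul, I.incl_mulRight, I.incl_mulLeft, id_apply])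
    exact congr($key x)

/-- A self-induced closed ideal of a biflat Banach algebra is biflat. -/
theorem IsBiflat.of_isSelfInduced_ideal (hB : IsBiflat 𝕜 B) (I : IdealEmbedding 𝕜 A B)
    (hA : IsSelfInduced 𝕜 A) : IsBiflat 𝕜 A := by
  obtain ⟨l, hlr, hll, hlπ⟩ := hB
  obtain ⟨T, hT⟩ := hA.exists_factor_dual I.compress
    (((compL 𝕜 A B 𝕜).flip I.incl).comp l)
    (fun a x b c f => by
      rw [I.compress_mul_left, ← comp_assoc]
      exact (hll _ _ _).trans (congr_arg _ (I.incl_mul _ _).symm))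
    (fun a b x c f => by
      rw [I.compress_mul_right, ← comp_assoc]
      exact (hlr _ _ _).trans (congr_arg _ (I.incl_mul _ _).symm))
  refine ⟨T, fun a f x => ?_, fun a f x => ?_, fun f => ?_⟩
  · have key : T (f.comp (rightAct 𝕜 a)) =
        (T f).comp ((ContinuousLinearMap.mul 𝕜 A).flip a) :=
      hA.ext₃ fun x y z => by
        rw [comp_apply, flip_apply, mul_apply', mul_assoc _ z, hT, hT, comp_assoc,
          I.rightAct_comp_compress]
    exact congr($key x)
  · have key : T (f.comp (leftAct 𝕜 a)) =
        (T f).comp (ContinuousLinearMap.mul 𝕜 A a) :=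
      hA.ext₃ fun x y z => by
        rw [comp_apply, mul_apply', ← mul_assoc, ← mul_assoc, hT, hT, comp_assoc,
          I.leftAct_comp_compress]
    exact congr($key x)
  · refine hA.ext₃ fun x y z => ?_
    -- The functional fed to `l` is now a pullback along multiplication on `B`, so `l` returns `u ↦
    -- f (x u z)`, evaluated at `y`.
    rw [hT, comp_assoc, I.mulMap_comp_compress, ← comp_assoc, comp_apply, hlπ]
    have h : I.mulLeft z (I.incl (I.mulRight x (I.incl y))) = x * y * z :=
      I.incl_injective (by simp only [I.incl_mul, I.incl_mulRight, I.incl_mulLeft])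
    exact congr_arg f h

end Ideal

end BanachTensor

end

theorem theorem2p5 {𝕜 : Type*} [RCLike 𝕜] {B : Type*} [NonUnitalNormedRing B] [NormedSpace 𝕜 B]
    [IsScalarTower 𝕜 B B] [SMulCommClass 𝕜 B B] [CompleteSpace B]
    (A : NonUnitalSubalgebra 𝕜 B) (hA : IsClosed (A : Set B))
    (hleft : ∀ b : B, ∀ a ∈ A, b * a ∈ A) (hright : ∀ b : B, ∀ a ∈ A, a * b ∈ A) :
    haveI : CompleteSpace A := hA.completeSpace_coe
    (BanachTensor.IsBiprojective 𝕜 B →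
      (BanachTensor.IsBiprojective 𝕜 A ↔ BanachTensor.IsSelfInduced 𝕜 A)) ∧
    (BanachTensor.IsBiflat 𝕜 B →
      (BanachTensor.IsBiflat 𝕜 A ↔ BanachTensor.IsSelfInduced 𝕜 A)) := by
  have : CompleteSpace A := hA.completeSpace_coe
  have I : BanachTensor.IdealEmbedding 𝕜 A B := .ofSubalgebra hleft hright
  exact ⟨fun hB => ⟨fun h => h.isSelfInduced, fun h => hB.of_isSelfInduced_ideal I h⟩,
    fun hB => ⟨fun h => h.isSelfInduced, fun h => hB.of_isSelfInduced_ideal I h⟩⟩
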